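/- Let $n,d$ be natural numbers such that $d$ is even and positive, $2d$ divides $n$, and $n/(2d)$ is even with $n/(2d)\ge 2$. Put $M=(n/d)^{d/2}$. Then there exist a $d$-dimensional polytope $P\subset\mathbb{R}^d$ with exactly $n/2$ facets and exactly $M$ vertices, and an orthogonal projection $\Pi:\mathbb{R}^d\to\mathbb{R}^2$ (that is, the orthogonal projection onto a two-dimensional linear subspace $U$ of $\mathbb{R}^d$, followed by a linear isometry $U\cong\mathbb{R}^2$), such that $$\Pi(P)=\operatorname{conv}\left\{\left(\tfrac{t}{M-1},\ \left(\tfrac{t}{M-1}\right)^2-\tfrac{t}{M-1}\right) : t\in\{0,1,\dots,M-1\}\right\},$$ and such that $\Pi$ maps the vertex set of $P$ onto the set of these $M$ points. -/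

import Mathlib

noncomputable section

/-- `P` is a polytope: the convex hull of finitely many points. -/
def IsPolytope {d : ℕ} (P : Set (EuclideanSpace ℝ (Fin d))) : Prop :=
  ∃ S : Set (EuclideanSpace ℝ (Fin d)), S.Finite ∧ P = convexHull ℝ S

/-- The dimension of a set, that is, of its affine hull (with the value `0` for the empty set). -/
def affDim {d : ℕ} (A : Set (EuclideanSpace ℝ (Fin d))) : ℕ :=
  Module.finrank ℝ (vectorSpan ℝ A)

/-- The vertices of `P`, that is, its extreme points. -/
def vertexSet {d : ℕ} (P : Set (EuclideanSpace ℝ (Fin d))) :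
    Set (EuclideanSpace ℝ (Fin d)) :=
  P.extremePoints ℝ

/-- `F` is a facet of `P`: a nonempty face (the set of maximizers over `P` of some linear
functional) whose dimension is one less than the dimension of `P`. -/
def IsFacet {d : ℕ} (P F : Set (EuclideanSpace ℝ (Fin d))) : Prop :=
  F.Nonempty ∧ IsExposed ℝ P F ∧ affDim F + 1 = affDim P

/-- The set of facets of `P`. -/
def facetSet {d : ℕ} (P : Set (EuclideanSpace ℝ (Fin d))) :
    Set (Set (EuclideanSpace ℝ (Fin d))) :=
  {F | IsFacet P F}

/-- `f : ℝ^d → ℝ^2` is an orthogonal projection: the orthogonal projection of `ℝ^d` onto a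
(necessarily two-dimensional) linear subspace `U`, followed by an identification of `U` with `ℝ^2`
through an orthonormal basis, that is, through a linear isometry. -/
def IsOrthogonalProjection {d : ℕ}
    (f : EuclideanSpace ℝ (Fin d) →ₗ[ℝ] EuclideanSpace ℝ (Fin 2)) : Prop :=
  ∃ (U : Submodule ℝ (EuclideanSpace ℝ (Fin d))) (e : U ≃ₗᵢ[ℝ] EuclideanSpace ℝ (Fin 2)),
    ∀ x, f x = e (U.orthogonalProjectionOnto x)

/-- The point `(x, x² - x)` of the parabola. -/
def parabolaPoint (x : ℝ) : EuclideanSpace ℝ (Fin 2) :=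
  !₂[x, x ^ 2 - x]

/-- The `M` points of the parabola with first coordinates `t / (M - 1)`, `t = 0, …, M - 1`. -/
def parabolaPoints (M : ℕ) : Set (EuclideanSpace ℝ (Fin 2)) :=
  {y | ∃ t : ℕ, t < M ∧ y = parabolaPoint ((t : ℝ) / ((M : ℝ) - 1))}

end

/-!
The polytope is built as a tower of `d / 2` polygons with `N = n / d` vertices each, combinatorially
a product of polygons. Suppose that a polytope `Q` in a space `E` has vertices `v t`, `t < M`, and
that a linear map `p` to the plane sends `v t` to the point `(t, t²)` of the standard parabola. The
new polytope lies in `E × ℝ²`, projects onto `Q`, and its fibre over `x ∈ Q` is an `N`-gon with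
vertices `foldVertex M j (p x)`, `j < N`: these lie on the standard parabola shifted vertically by
the height of `p x` above the parabola, and have as first coordinates the nodes
`τ j = M j + t` for even `j` and `τ j = M j + (M - 1 - t)` for odd `j`, where `t = (p x).1`.

The alternating sign of `t` has two effects. The chord between the parabola points over `r` and `s`
has slope `r + s`, and for nodes of opposite parity this sum does not depend on `t`; so all edges of
the fibre keep their directions while `x` varies, and the edge inequalities are affine in `(x, y)`
(`chordHeight_foldNode`). The edge from the last vertex back to the first one has this property
because `N` is even. Also, as `t` runs through `0, …, M - 1`, the nodes run through
`0, …, N M - 1`, each value being taken once. Hence the projection `(x, y) ↦ y` maps the `N M` new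
vertices to the points `(u, u²)`, `u < N M`, and the construction can be iterated
(`IsParabolicPolytope.step`), starting from a point.

Three facts about the resulting polytope are needed. Its description by vertices agrees with its
description by inequalities because the fibre over `x` depends affinely on `x` and each fibre
polygon is cut out by its edges (`mem_convexHull_of_edgeSlack_nonneg`). The `(d / 2) N = n / 2`
inequalities have a strict solution and each is irredundant, so they correspond to the facets
(`ncard_facetSet`). The projections of the points `v t` are in convex position, so all of these
points are vertices (`extremePoints_convexHull_of_parabola`). Finally, a linear change of
coordinates in the plane replaces `(t, t²)` by the prescribed points, and a change of coordinates in
`E` turns the surjection onto the plane into an orthogonal projection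
(`exists_isOrthogonalProjection`).
-/

/-! ### Polygons inscribed in the parabola -/

/-- The vertical distance from `z` down to the line through the points `(r, r²)` and `(s, s²)` of
the standard parabola. -/
def chordHeight (r s : ℝ) (z : ℝ × ℝ) : ℝ :=
  z.2 - (r + s) * z.1 + r * s

/-- The slacks at `z` of the edge inequalities of the polygon with vertices `(τ j, τ j ^ 2)`,
`j ≤ K`. The index `some j` stands for the edge from vertex `j` to vertex `j + 1`, which bounds the
polygon from below, and `none` for the edge from vertex `0` to vertex `K`, which bounds it from
above. -/
def edgeSlack {K : ℕ} (τ : ℕ → ℝ) (z : ℝ × ℝ) : Option (Fin K) → ℝ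
  | none => -chordHeight (τ 0) (τ K) z
  | some j => chordHeight (τ j) (τ (j + 1)) z

lemma chordHeight_vertex (r s c : ℝ) : chordHeight r s (c, c ^ 2) = (c - r) * (c - s) := by
  simp only [chordHeight]; ring

lemma chordHeight_midpoint (r s c d : ℝ) :
    chordHeight r s ((c + d) / 2, (c ^ 2 + d ^ 2) / 2) =
      ((c - r) * (c - s) + (d - r) * (d - s)) / 2 := by
  simp only [chordHeight]; ring

lemma consecutive_nodes_mul_nonneg {τ : ℕ → ℝ} (hτ : StrictMono τ) (j l : ℕ) :
    0 ≤ (τ l - τ j) * (τ l - τ (j + 1)) := by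
  rcases le_or_gt l j with h | h
  · have h1 := hτ.monotone h
    have h2 := hτ (Nat.lt_succ_of_le h)
    exact mul_nonneg_of_nonpos_of_nonpos (by linarith) (by linarith)
  · have h1 := hτ h
    have h2 := hτ.monotone (Nat.succ_le_of_lt h)
    exact mul_nonneg (by linarith) (by simpa using h2)

lemma consecutive_nodes_mul_pos {τ : ℕ → ℝ} (hτ : StrictMono τ) {j l : ℕ} (h1 : l ≠ j)
    (h2 : l ≠ j + 1) : 0 < (τ l - τ j) * (τ l - τ (j + 1)) :=
  (consecutive_nodes_mul_nonneg hτ j l).lt_of_ne'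
    (mul_ne_zero (sub_ne_zero.2 (hτ.injective.ne h1)) (sub_ne_zero.2 (hτ.injective.ne h2)))

lemma extreme_nodes_mul_nonpos {τ : ℕ → ℝ} (hτ : StrictMono τ) {K l : ℕ} (hl : l ≤ K) :
    (τ l - τ 0) * (τ l - τ K) ≤ 0 :=
  mul_nonpos_of_nonneg_of_nonpos (sub_nonneg.2 (hτ.monotone l.zero_le))
    (sub_nonpos.2 (hτ.monotone hl))

lemma extreme_nodes_mul_neg {τ : ℕ → ℝ} (hτ : StrictMono τ) {K l : ℕ} (h0 : 0 < l) (hl : l < K) :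
    (τ l - τ 0) * (τ l - τ K) < 0 :=
  mul_neg_of_pos_of_neg (sub_pos.2 (hτ h0)) (sub_neg.2 (hτ hl))

lemma edgeSlack_vertex_nonneg {K : ℕ} {τ : ℕ → ℝ} (hτ : StrictMono τ) {l : ℕ} (hl : l ≤ K)
    (e : Option (Fin K)) : 0 ≤ edgeSlack τ (τ l, τ l ^ 2) e := by
  cases e with
  | none =>
    simpa only [edgeSlack, chordHeight_vertex, neg_nonneg] using extreme_nodes_mul_nonpos hτ hl
  | some j =>
    simpa only [edgeSlack, chordHeight_vertex] using consecutive_nodes_mul_nonneg hτ j l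

lemma exists_edgeSlack_pos {K : ℕ} (hK : 2 ≤ K) {τ : ℕ → ℝ} (hτ : StrictMono τ) :
    ∃ z, ∀ e : Option (Fin K), 0 < edgeSlack τ z e := by
  -- The barycentre of three vertices works: no edge contains all three of them.
  refine ⟨((τ 0 + τ 1 + τ 2) / 3, (τ 0 ^ 2 + τ 1 ^ 2 + τ 2 ^ 2) / 3), ?_⟩
  have key : ∀ r s, chordHeight r s ((τ 0 + τ 1 + τ 2) / 3, (τ 0 ^ 2 + τ 1 ^ 2 + τ 2 ^ 2) / 3) =
      ((τ 0 - r) * (τ 0 - s) + (τ 1 - r) * (τ 1 - s) + (τ 2 - r) * (τ 2 - s)) / 3 := by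
    intro r s; simp only [chordHeight]; ring
  rintro (_ | j)
  · simp only [edgeSlack, key]
    have h0 := extreme_nodes_mul_nonpos hτ (Nat.zero_le K)
    have h1 := extreme_nodes_mul_neg hτ Nat.one_pos (by lia : 1 < K)
    have h2 := extreme_nodes_mul_nonpos hτ hK
    linarith
  · simp only [edgeSlack, key]
    have h0 := consecutive_nodes_mul_nonneg hτ j 0
    have h1 := consecutive_nodes_mul_nonneg hτ j 1
    have h2 := consecutive_nodes_mul_nonneg hτ j 2
    by_cases hj : (j : ℕ) = 0
    · have := consecutive_nodes_mul_pos hτ (j := j) (l := 2) (by lia) (by lia)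
      linarith
    · have := consecutive_nodes_mul_pos hτ (j := j) (l := 0) (by lia) (by lia)
      linarith

/-- Every edge inequality is irredundant: at the midpoint of an edge, only the inequality of that
edge is tight. -/
lemma exists_edgeSlack_eq_zero {K : ℕ} (hK : 2 ≤ K) {τ : ℕ → ℝ} (hτ : StrictMono τ)
    (e : Option (Fin K)) :
    ∃ z, edgeSlack τ z e = 0 ∧ ∀ e' ≠ e, 0 < edgeSlack τ z e' := by
  cases e with
  | none =>
    refine ⟨((τ 0 + τ K) / 2, (τ 0 ^ 2 + τ K ^ 2) / 2), ?_, ?_⟩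
    · simp only [edgeSlack, chordHeight_midpoint]; ring
    · rintro (_ | l) hl
      · exact absurd rfl hl
      · simp only [edgeSlack, chordHeight_midpoint]
        have h0 := consecutive_nodes_mul_nonneg hτ l 0
        have h1 := consecutive_nodes_mul_nonneg hτ l K
        by_cases hl0 : (l : ℕ) = 0
        · have := consecutive_nodes_mul_pos hτ (j := l) (l := K) (by lia) (by lia)
          linarith
        · have := consecutive_nodes_mul_pos hτ (j := l) (l := 0) (by lia) (by lia)
          linarith
  | some j =>
    refine ⟨((τ j + τ (j + 1)) / 2, (τ j ^ 2 + τ (j + 1) ^ 2) / 2), ?_, ?_⟩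
    · simp only [edgeSlack, chordHeight_midpoint]; ring
    · have hjK := j.isLt
      rintro (_ | l) hl
      · simp only [edgeSlack, chordHeight_midpoint]
        have h0 := extreme_nodes_mul_nonpos hτ hjK.le
        have h1 := extreme_nodes_mul_nonpos hτ hjK
        by_cases hj0 : (j : ℕ) = 0
        · have := extreme_nodes_mul_neg hτ (Nat.succ_pos j) (by lia : (j : ℕ) + 1 < K)
          simp only [Nat.succ_eq_add_one] at *
          linarith
        · have := extreme_nodes_mul_neg hτ (Nat.pos_of_ne_zero hj0) hjK
          simp only [Nat.succ_eq_add_one] at *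
          linarith
      · have hne : (l : ℕ) ≠ j := fun h => hl (by rw [Fin.ext h])
        simp only [edgeSlack, chordHeight_midpoint]
        have h0 := consecutive_nodes_mul_nonneg hτ l j
        have h1 := consecutive_nodes_mul_nonneg hτ l (j + 1)
        by_cases hlj : (j : ℕ) = l + 1
        · have := consecutive_nodes_mul_pos hτ (j := l) (l := j + 1) (by lia) (by lia)
          linarith
        · have := consecutive_nodes_mul_pos hτ (j := l) (l := j) (by lia) (by lia)
          linarith

/-- A point on the line through `(r, r²)` and `(s, s²)` whose abscissa lies between `r` and `s` is
a convex combination of these two points. -/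
lemma chord_mem_of_convex {C : Set (ℝ × ℝ)} (hC : Convex ℝ C) {r s x : ℝ} (hrs : r < s)
    (hr : (r, r ^ 2) ∈ C) (hs : (s, s ^ 2) ∈ C) (h1 : r ≤ x) (h2 : x ≤ s) :
    (x, (r + s) * x - r * s) ∈ C := by
  have h0 : 0 < s - r := sub_pos.2 hrs
  have := hC hr hs (a := (s - x) / (s - r)) (b := (x - r) / (s - r))
    (div_nonneg (by linarith) h0.le) (div_nonneg (by linarith) h0.le) (by field_simp; ring)
  convert this using 1
  ext
  · simp; field_simp; ring
  · simp; field_simp; ring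

/-- The edge inequalities cut out the polygon: the first lower edge and the upper edge bound the
abscissa from the left, the last lower edge and the upper edge bound it from the right, and a point
above the lower edge at its abscissa and below the upper edge is between two points of the
polygon. -/
lemma mem_convexHull_of_edgeSlack_nonneg {K : ℕ} (hK : 2 ≤ K) {τ : ℕ → ℝ} (hτ : StrictMono τ)
    {z : ℝ × ℝ} (hz : ∀ e : Option (Fin K), 0 ≤ edgeSlack τ z e) :
    z ∈ convexHull ℝ ((fun j => (τ j, τ j ^ 2)) '' Set.Iic K) := by
  set C := convexHull ℝ ((fun j => (τ j, τ j ^ 2)) '' Set.Iic K)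
  have hC : Convex ℝ C := convex_convexHull ℝ _
  have hv : ∀ j ≤ K, (τ j, τ j ^ 2) ∈ C := fun j hj => subset_convexHull ℝ _ ⟨j, hj, rfl⟩
  have hlow : ∀ j < K, (τ j + τ (j + 1)) * z.1 - τ j * τ (j + 1) ≤ z.2 := by
    intro j hj
    have := hz (some ⟨j, hj⟩)
    simp only [edgeSlack, chordHeight] at this
    linarith
  have hup : z.2 ≤ (τ 0 + τ K) * z.1 - τ 0 * τ K := by
    have := hz none
    simp only [edgeSlack, chordHeight] at this
    linarith
  have hleft : τ 0 ≤ z.1 := by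
    have h1 := hlow 0 (by lia)
    have h2 : τ (0 + 1) < τ K := hτ (by lia)
    nlinarith
  have hright : z.1 ≤ τ K := by
    obtain ⟨L, rfl⟩ : ∃ L, K = L + 1 := ⟨K - 1, by lia⟩
    have h1 := hlow L (by lia)
    have h2 : τ 0 < τ L := hτ (by lia)
    nlinarith
  obtain ⟨j, hj, hj1, hj2⟩ : ∃ j < K, τ j ≤ z.1 ∧ z.1 ≤ τ (j + 1) := by
    have hex : ∃ j, z.1 ≤ τ (j + 1) := ⟨K, hright.trans (hτ.monotone K.le_succ)⟩
    classical
    by_cases h0 : Nat.find hex = 0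
    · exact ⟨0, by lia, hleft, by simpa [h0] using Nat.find_spec hex⟩
    · obtain ⟨i, hi⟩ := Nat.exists_eq_succ_of_ne_zero h0
      have h1 : τ (i + 1) < z.1 := not_le.1 (Nat.find_min hex (by lia))
      refine ⟨i + 1, hτ.lt_iff_lt.1 (h1.trans_le hright), h1.le, ?_⟩
      simpa [hi] using Nat.find_spec hex
  have hP := chord_mem_of_convex hC (hτ j.lt_succ_self) (hv j hj.le) (hv (j + 1) hj) hj1 hj2
  have hQ := chord_mem_of_convex hC (hτ (by lia : 0 < K)) (hv 0 K.zero_le) (hv K le_rfl) hleft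
    hright
  -- Points of `C` on the vertical line through `z` form a convex set.
  have hconv : Convex ℝ {y : ℝ | (z.1, y) ∈ C} := by
    intro y hy y' hy' α β hα hβ hαβ
    have := hC hy hy' hα hβ hαβ
    simpa [← add_mul, hαβ] using this
  exact hconv.ordConnected.out hP hQ ⟨hlow j hj, hup⟩

/-! ### Reflected subdivision of the parabola -/

/-- The constant term of `foldNode M j`. -/
def foldOffset (M : ℝ) (j : ℕ) : ℝ :=
  if Even j then M * j else M * (j + 1) - 1

/-- The parameter `t ∈ [0, M - 1]`, moved into the `j`-th interval `[M j, M j + M - 1]` by a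
translation for even `j` and by a reflection for odd `j`. -/
def foldNode (M t : ℝ) (j : ℕ) : ℝ :=
  foldOffset M j + (-1) ^ j * t

/-- The affine map of the plane that preserves the height `q.2 - q.1 ^ 2` above the parabola and
acts on the first coordinate by `foldNode M · j`. -/
def foldVertex (M : ℝ) (j : ℕ) (q : ℝ × ℝ) : ℝ × ℝ :=
  (foldNode M q.1 j, foldNode M q.1 j ^ 2 + (q.2 - q.1 ^ 2))

lemma foldNode_of_even {j : ℕ} (hj : Even j) (M t : ℝ) : foldNode M t j = M * j + t := by
  simp [foldNode, foldOffset, hj, hj.neg_one_pow]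

lemma foldNode_of_odd {j : ℕ} (hj : Odd j) (M t : ℝ) :
    foldNode M t j = M * (j + 1) - 1 - t := by
  simp [foldNode, foldOffset, Nat.not_even_iff_odd.2 hj, hj.neg_one_pow]; ring

lemma foldNode_strictMono {M t : ℝ} (h0 : 0 ≤ t) (h1 : t ≤ M - 1) : StrictMono (foldNode M t) := by
  refine strictMono_nat_of_lt_succ fun j => ?_
  rcases Nat.even_or_odd j with hj | hj
  · rw [foldNode_of_even hj, foldNode_of_odd hj.add_one]
    push_cast
    linarith
  · rw [foldNode_of_odd hj, foldNode_of_even hj.add_one]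
    push_cast
    linarith

lemma foldVertex_convexComb (M : ℝ) (j : ℕ) (q q' : ℝ × ℝ) {α β : ℝ} (h : α + β = 1) :
    foldVertex M j (α • q + β • q') = α • foldVertex M j q + β • foldVertex M j q' := by
  obtain rfl : β = 1 - α := by linarith
  have hs : ((-1 : ℝ) ^ j) ^ 2 = 1 := by rw [← pow_mul, mul_comm, pow_mul]; simp
  ext
  · simp only [foldVertex, foldNode, Prod.fst_add, Prod.smul_fst, smul_eq_mul]; ring
  · simp only [foldVertex, foldNode, Prod.fst_add, Prod.snd_add, Prod.smul_fst, Prod.smul_snd,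
      smul_eq_mul]
    linear_combination ((α * q.1 + (1 - α) * q'.1) ^ 2 - α * q.1 ^ 2 - (1 - α) * q'.1 ^ 2) * hs

/-- The linear part, as a function of the pair `(q, y)`, of the height of `y - (0, q.2 - q.1 ^ 2)`
above the chord between the nodes `foldNode M q.1 i` and `foldNode M q.1 j`. -/
def chordForm (M : ℝ) (i j : ℕ) : (ℝ × ℝ) × (ℝ × ℝ) →ₗ[ℝ] ℝ where
  toFun z := z.2.2 - (foldOffset M i + foldOffset M j) * z.2.1
    + (-1) ^ i * (foldOffset M j - foldOffset M i) * z.1.1 - z.1.2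
  map_add' z z' := by simp only [Prod.fst_add, Prod.snd_add]; ring
  map_smul' c z := by simp only [Prod.smul_fst, Prod.smul_snd, smul_eq_mul, RingHom.id_apply]; ring

/-- For indices of opposite parity, the sum of the two nodes, which is the slope of the chord, does
not depend on `q`, so that the height above the chord is affine in `(q, y)`. -/
lemma chordHeight_foldNode (M : ℝ) {i j : ℕ} (hij : Odd (i + j)) (q y : ℝ × ℝ) :
    chordHeight (foldNode M q.1 i) (foldNode M q.1 j) (y.1, y.2 - (q.2 - q.1 ^ 2)) =
      chordForm M i j (q, y) + foldOffset M i * foldOffset M j := by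
  have hj : (-1 : ℝ) ^ j = -(-1) ^ i := by
    have h := hij.neg_one_pow (α := ℝ)
    rw [pow_add] at h
    rcases neg_one_pow_eq_or ℝ i with hi | hi <;> rw [hi] at h ⊢ <;> linarith
  have hs : ((-1 : ℝ) ^ i) ^ 2 = 1 := by rw [← pow_mul, mul_comm, pow_mul]; simp
  simp only [chordHeight, chordForm, foldNode, hj, LinearMap.coe_mk, AddHom.coe_mk]
  linear_combination (-q.1 ^ 2) * hs

/-- The linear functionals in `(q, y)` of the edge inequalities of the polygon with vertices
`foldVertex M j q`, `j ≤ K`. -/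
def edgeForm {K : ℕ} (M : ℝ) : Option (Fin K) → (ℝ × ℝ) × (ℝ × ℝ) →ₗ[ℝ] ℝ
  | none => chordForm M 0 K
  | some j => -chordForm M j (j + 1)

/-- The right-hand sides that go with `edgeForm`. -/
def edgeBound {K : ℕ} (M : ℝ) : Option (Fin K) → ℝ
  | none => -(foldOffset M 0 * foldOffset M K)
  | some j => foldOffset M j * foldOffset M (j + 1)

lemma edgeBound_sub_edgeForm (M : ℝ) {K : ℕ} (hK : Odd K) (q y : ℝ × ℝ) (e : Option (Fin K)) :
    edgeBound M e - edgeForm M e (q, y) =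
      edgeSlack (foldNode M q.1) (y.1, y.2 - (q.2 - q.1 ^ 2)) e := by
  cases e with
  | none =>
    rw [edgeSlack, chordHeight_foldNode M (by simpa using hK)]
    simp only [edgeBound, edgeForm]; ring
  | some j =>
    rw [edgeSlack, chordHeight_foldNode M (by use (j : ℕ); ring)]
    simp only [edgeBound, edgeForm, LinearMap.neg_apply]; ring

/-! ### The tower of polygons -/

/-- The inequalities `a i x ≤ b i` describe a polytope, with the points `v t`, `t < M`, spanning it,
such that `p` sends `v t` to the point `(t, t²)` of the standard parabola. The system has a strict
solution, and for each index it has a solution at which only that inequality is tight. -/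
structure IsParabolicPolytope {E ι : Type*} [AddCommGroup E] [Module ℝ E] (M : ℕ)
    (p : E →ₗ[ℝ] ℝ × ℝ) (v : ℕ → E) (a : ι → E →ₗ[ℝ] ℝ) (b : ι → ℝ) : Prop where
  hull : convexHull ℝ (v '' Set.Iio M) = {x | ∀ i, a i x ≤ b i}
  proj : ∀ t < M, p (v t) = ((t : ℝ), (t : ℝ) ^ 2)
  strict : ∃ x, ∀ i, a i x < b i
  irredundant : ∀ i, ∃ x, a i x = b i ∧ ∀ j ≠ i, a j x < b j

lemma forall_le_of_eq_of_forall_ne_lt {ι : Type*} {x b : ι → ℝ} {i : ι} (h : x i = b i)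
    (h' : ∀ j ≠ i, x j < b j) (j : ι) : x j ≤ b j := by
  by_cases hj : j = i
  · rw [hj, h]
  · exact (h' j hj).le

section Step

variable {E ι : Type*} [AddCommGroup E] [Module ℝ E]

/-- The functionals describing the polytope whose fibre over a point `x` of a given polytope is the
polygon with vertices `foldVertex M j (p x)`. -/
def stepForm (K M : ℕ) (p : E →ₗ[ℝ] ℝ × ℝ) (a : ι → E →ₗ[ℝ] ℝ) :
    ι ⊕ Option (Fin K) → E × (ℝ × ℝ) →ₗ[ℝ] ℝ :=
  Sum.elim (fun i => a i ∘ₗ LinearMap.fst ℝ E (ℝ × ℝ))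
    fun e => edgeForm M e ∘ₗ p.prodMap LinearMap.id

/-- The right-hand sides that go with `stepForm`. -/
def stepBound (K M : ℕ) (b : ι → ℝ) : ι ⊕ Option (Fin K) → ℝ :=
  Sum.elim b fun e => edgeBound M e

/-- The vertex of the new polytope over the parameter `u`. The quotient `u / M` selects the vertex
of the fibre polygon; the base vertex is selected by the remainder `u % M`, read backwards when the
quotient is odd. -/
def stepVertex (M : ℕ) (p : E →ₗ[ℝ] ℝ × ℝ) (v : ℕ → E) (u : ℕ) : E × (ℝ × ℝ) :=
  let x := v (if Even (u / M) then u % M else M - 1 - u % M)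
  (x, foldVertex M (u / M) (p x))

lemma stepVertex_fold {M : ℕ} (p : E →ₗ[ℝ] ℝ × ℝ) (v : ℕ → E) (j : ℕ) {t : ℕ} (ht : t < M) :
    stepVertex M p v (M * j + if Even j then t else M - 1 - t) =
      (v t, foldVertex M j (p (v t))) := by
  have hlt : (if Even j then t else M - 1 - t) < M := by split_ifs <;> lia
  have hdiv : (M * j + if Even j then t else M - 1 - t) / M = j := by
    rw [Nat.mul_add_div (by lia), Nat.div_eq_of_lt hlt, add_zero]
  have hmod : (M * j + if Even j then t else M - 1 - t) % M = if Even j then t else M - 1 - t := by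
    rw [Nat.mul_add_mod, Nat.mod_eq_of_lt hlt]
  have hsel : (if Even j then (if Even j then t else M - 1 - t)
      else M - 1 - if Even j then t else M - 1 - t) = t := by
    split_ifs <;> lia
  simp only [stepVertex, hdiv, hmod, hsel]

variable {M : ℕ} {p : E →ₗ[ℝ] ℝ × ℝ} {v : ℕ → E} {a : ι → E →ₗ[ℝ] ℝ} {b : ι → ℝ}

lemma IsParabolicPolytope.proj_fst_mem (h : IsParabolicPolytope M p v a b) {x : E}
    (hx : ∀ i, a i x ≤ b i) : 0 ≤ (p x).1 ∧ (p x).1 ≤ M - 1 := by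
  have hconv : Convex ℝ {x : E | (p x).1 ∈ Set.Icc (0 : ℝ) (M - 1)} :=
    (convex_Icc _ _).linear_preimage (LinearMap.fst ℝ ℝ ℝ ∘ₗ p)
  have hsub : convexHull ℝ (v '' Set.Iio M) ⊆ {x : E | (p x).1 ∈ Set.Icc (0 : ℝ) (M - 1)} := by
    refine convexHull_min ?_ hconv
    rintro _ ⟨t, ht, rfl⟩
    have ht' : (t : ℝ) + 1 ≤ M := by exact_mod_cast (show t < M from ht)
    simp only [Set.mem_ofPred_eq, h.proj t ht, Set.mem_Icc]
    exact ⟨t.cast_nonneg, by linarith⟩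
  rw [h.hull] at hsub
  exact hsub hx

lemma IsParabolicPolytope.strictMono (h : IsParabolicPolytope M p v a b) {x : E}
    (hx : ∀ i, a i x ≤ b i) : StrictMono (foldNode M (p x).1) :=
  foldNode_strictMono (h.proj_fst_mem hx).1 (h.proj_fst_mem hx).2

lemma stepBound_sub_stepForm_inr {K : ℕ} (hK : Odd K) (x : E) (y : ℝ × ℝ) (e : Option (Fin K)) :
    stepBound K M b (.inr e) - stepForm K M p a (.inr e) (x, y) =
      edgeSlack (foldNode M (p x).1) (y.1, y.2 - ((p x).2 - (p x).1 ^ 2)) e :=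
  edgeBound_sub_edgeForm M hK (p x) y e

lemma stepVertex_proj (h : IsParabolicPolytope M p v a b) {K u : ℕ} (hu : u < M * (K + 1)) :
    (stepVertex M p v u).2 = ((u : ℝ), (u : ℝ) ^ 2) := by
  have hM : 0 < M := Nat.pos_of_mul_pos_right (by lia : 0 < M * (K + 1))
  have hmod := Nat.mod_lt u hM
  have hdm : (M : ℝ) * (u / M : ℕ) + (u % M : ℕ) = u := by exact_mod_cast Nat.div_add_mod u M
  have hcast : ((M - 1 - u % M : ℕ) : ℝ) = M - 1 - (u % M : ℕ) := by
    rw [Nat.sub_sub, Nat.cast_sub (by lia)]; push_cast; ring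
  have key : foldNode M
      (p (v (if Even (u / M) then u % M else M - 1 - u % M))).1 (u / M) = u := by
    split_ifs with hj
    · rw [h.proj _ hmod, foldNode_of_even hj, hdm]
    · rw [h.proj _ (by lia), foldNode_of_odd (Nat.not_even_iff_odd.1 hj), hcast]
      linarith
  have hpar : (p (v (if Even (u / M) then u % M else M - 1 - u % M))).2 =
      (p (v (if Even (u / M) then u % M else M - 1 - u % M))).1 ^ 2 := by
    rw [h.proj _ (by split_ifs <;> lia)]
  simp only [stepVertex, foldVertex, key, hpar, sub_self, add_zero]

lemma IsParabolicPolytope.mem_of_lt (h : IsParabolicPolytope M p v a b) {t : ℕ} (ht : t < M)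
    (i : ι) : a i (v t) ≤ b i := by
  have : v t ∈ {x | ∀ i, a i x ≤ b i} := h.hull ▸ subset_convexHull ℝ _ ⟨t, ht, rfl⟩
  exact this i

/-- The vertical translation by the height of `p x` above the parabola carries the polygon inscribed
in the standard parabola to the fibre over `x`. -/
lemma stepForm_inr_translate {K : ℕ} (hK : Odd K) (x : E) (z : ℝ × ℝ) (e : Option (Fin K)) :
    stepBound K M b (.inr e)
        - stepForm K M p a (.inr e) (x, (z.1, z.2 + ((p x).2 - (p x).1 ^ 2))) =
      edgeSlack (foldNode M (p x).1) z e := by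
  rw [stepBound_sub_stepForm_inr hK]
  simp

lemma IsParabolicPolytope.step_hull (h : IsParabolicPolytope M p v a b) {K : ℕ} (hK : Odd K)
    (hK2 : 2 ≤ K) :
    convexHull ℝ (stepVertex M p v '' Set.Iio (M * (K + 1))) =
      {z | ∀ i, stepForm K M p a i z ≤ stepBound K M b i} := by
  apply Set.Subset.antisymm
  · refine convexHull_min ?_ ?_
    · rintro _ ⟨u, hu, rfl⟩
      have hM : 0 < M := Nat.pos_of_mul_pos_right (by
        have : u < M * (K + 1) := hu
        lia : 0 < M * (K + 1))
      have hmod := Nat.mod_lt u hM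
      have hx : ∀ i, a i (v (if Even (u / M) then u % M else M - 1 - u % M)) ≤ b i :=
        h.mem_of_lt (by split_ifs <;> lia)
      have hl : u / M ≤ K := Nat.lt_succ_iff.1 (Nat.div_lt_of_lt_mul hu)
      rintro (i | e)
      · exact hx i
      · rw [← sub_nonneg, stepVertex, foldVertex]
        have := edgeSlack_vertex_nonneg (h.strictMono hx) hl e
        rw [← stepForm_inr_translate (M := M) (p := p) (a := a) (b := b) hK] at this
        exact this
    · simp only [Set.ofPred_forall]
      exact convex_iInter fun i => convex_halfSpace_le (stepForm K M p a i).isLinear _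
  · rintro ⟨x, y⟩ hxy
    set C := convexHull ℝ (stepVertex M p v '' Set.Iio (M * (K + 1)))
    have hC : Convex ℝ C := convex_convexHull ℝ _
    have hx : ∀ i, a i x ≤ b i := fun i => hxy (.inl i)
    -- Each section `x ↦ (x, foldVertex M j (p x))` is affine and maps the vertices into `C`.
    have hsection : ∀ j ≤ K, (x, foldVertex M j (p x)) ∈ C := by
      intro j hj
      have hconv : Convex ℝ {x : E | (x, foldVertex M j (p x)) ∈ C} := by
        intro x₁ h₁ x₂ h₂ α β hα hβ hαβ
        have := hC h₁ h₂ hα hβ hαβ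
        simp only [Set.mem_ofPred_eq, map_add, map_smul]
        rw [foldVertex_convexComb _ _ _ _ hαβ]
        exact this
      have hsub : convexHull ℝ (v '' Set.Iio M) ⊆ {x : E | (x, foldVertex M j (p x)) ∈ C} := by
        refine convexHull_min ?_ hconv
        rintro _ ⟨t, ht, rfl⟩
        have ht' : t < M := ht
        refine subset_convexHull ℝ _ ⟨_, ?_, stepVertex_fold p v j ht'⟩
        have h1 : (if Even j then t else M - 1 - t) < M := by split_ifs <;> lia
        have h2 : M * j ≤ M * K := Nat.mul_le_mul_left M hj
        simp only [Set.mem_Iio, mul_add, mul_one]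
        lia
      rw [h.hull] at hsub
      exact hsub hx
    have hpoly : (y.1, y.2 - ((p x).2 - (p x).1 ^ 2)) ∈
        convexHull ℝ ((fun j => (foldNode M (p x).1 j, foldNode M (p x).1 j ^ 2)) '' Set.Iic K) := by
      refine mem_convexHull_of_edgeSlack_nonneg hK2 (h.strictMono hx) fun e => ?_
      rw [← stepBound_sub_stepForm_inr (M := M) (p := p) (a := a) (b := b) hK, sub_nonneg]
      exact hxy (.inr e)
    have hconv : Convex ℝ {z : ℝ × ℝ | (x, (z.1, z.2 + ((p x).2 - (p x).1 ^ 2))) ∈ C} := by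
      intro z₁ h₁ z₂ h₂ α β hα hβ hαβ
      have := hC h₁ h₂ hα hβ hαβ
      obtain rfl : β = 1 - α := by linarith
      simp only [Set.mem_ofPred_eq]
      convert this using 1
      ext
      · simp [← add_smul]
      · simp
      · simp; ring
    have hsub : (fun j => (foldNode M (p x).1 j, foldNode M (p x).1 j ^ 2)) '' Set.Iic K ⊆
        {z : ℝ × ℝ | (x, (z.1, z.2 + ((p x).2 - (p x).1 ^ 2))) ∈ C} := by
      rintro _ ⟨j, hj, rfl⟩
      exact hsection j hj
    have := convexHull_min hsub hconv hpoly
    simpa using this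

/-- One step of the construction: it adds two dimensions and `K + 1` inequalities, and multiplies
the number of vertices by `K + 1`. The oddness of `K` makes the upper edge of the fibre join
vertices of opposite parity, so that its direction is constant like those of the lower edges. -/
lemma IsParabolicPolytope.step (h : IsParabolicPolytope M p v a b) {K : ℕ} (hK : Odd K)
    (hK2 : 2 ≤ K) :
    IsParabolicPolytope (M * (K + 1)) (LinearMap.snd ℝ E (ℝ × ℝ)) (stepVertex M p v)
      (stepForm K M p a) (stepBound K M b) where
  hull := h.step_hull hK hK2
  proj u hu := stepVertex_proj h hu
  strict := by
    obtain ⟨x, hx⟩ := h.strict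
    obtain ⟨z, hz⟩ := exists_edgeSlack_pos hK2 (h.strictMono fun i => (hx i).le)
    refine ⟨(x, (z.1, z.2 + ((p x).2 - (p x).1 ^ 2))), ?_⟩
    rintro (i | e)
    · exact hx i
    · rw [← sub_pos, stepForm_inr_translate hK]
      exact hz e
  irredundant := by
    rintro (i | e)
    · obtain ⟨x, hx, hx'⟩ := h.irredundant i
      obtain ⟨z, hz⟩ := exists_edgeSlack_pos hK2
        (h.strictMono (forall_le_of_eq_of_forall_ne_lt (x := fun j => a j x) hx hx'))
      refine ⟨(x, (z.1, z.2 + ((p x).2 - (p x).1 ^ 2))), hx, ?_⟩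
      rintro (j | e) hj
      · exact hx' j fun hji => hj (by rw [hji])
      · rw [← sub_pos, stepForm_inr_translate hK]
        exact hz e
    · obtain ⟨x, hx⟩ := h.strict
      obtain ⟨z, hz, hz'⟩ := exists_edgeSlack_eq_zero hK2 (h.strictMono fun i => (hx i).le) e
      refine ⟨(x, (z.1, z.2 + ((p x).2 - (p x).1 ^ 2))), ?_, ?_⟩
      · rw [← stepForm_inr_translate (M := M) (p := p) (a := a) (b := b) hK, sub_eq_zero] at hz
        exact hz.symm
      · rintro (j | e') hj
        · exact hx j
        · rw [← sub_pos, stepForm_inr_translate hK]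
          exact hz' e' fun hee => hj (by rw [hee])

end Step

/-- The tower of `k` steps over the one-point polytope in the zero-dimensional space. -/
theorem exists_isParabolicPolytope {K : ℕ} (hK : Odd K) (hK2 : 2 ≤ K) (k : ℕ) :
    ∃ (E : Type) (_ : AddCommGroup E) (_ : Module ℝ E) (ι : Type) (p : E →ₗ[ℝ] ℝ × ℝ) (v : ℕ → E)
      (a : ι → E →ₗ[ℝ] ℝ) (b : ι → ℝ),
      Module.Finite ℝ E ∧ Module.finrank ℝ E = 2 * k ∧ Finite ι ∧ Nat.card ι = k * (K + 1) ∧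
      (k ≠ 0 → Function.Surjective p) ∧ IsParabolicPolytope ((K + 1) ^ k) p v a b := by
  induction k with
  | zero =>
    refine ⟨PUnit, inferInstance, inferInstance, Empty, 0, fun _ => 0, Empty.elim, Empty.elim,
      inferInstance, Module.finrank_zero_of_subsingleton, inferInstance, by simp, by simp, ?_⟩
    refine ⟨?_, ?_, ⟨0, by simp⟩, by simp⟩
    · ext x
      simp
    · intro t ht
      obtain rfl : t = 0 := by simpa using ht
      ext <;> simp
  | succ k ih =>
    obtain ⟨E, _, _, ι, p, v, a, b, hfin, hrank, hι, hcard, -, h⟩ := ih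
    have h' := h.step hK hK2
    rw [← pow_succ] at h'
    refine ⟨E × (ℝ × ℝ), inferInstance, inferInstance, ι ⊕ Option (Fin K), _, _, _, _,
      inferInstance, ?_, inferInstance, ?_, fun _ => LinearMap.snd_surjective, h'⟩
    · rw [Module.finrank_prod, hrank, Module.finrank_prod, Module.finrank_self]; ring
    · rw [Nat.card_sum, hcard, Finite.card_option, Nat.card_fin]; ring

/-! ### Facets of an irredundant system of inequalities -/

section Facets

variable {E ι : Type*} [AddCommGroup E] [Module ℝ E] [Finite ι]

/-- A point at which the inequalities outside `s` are strict can be moved a little in any direction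
that preserves the values of the functionals in `s`. -/
lemma exists_pos_add_smul_le {a : ι → E →ₗ[ℝ] ℝ} {b : ι → ℝ} {z w : E} {s : Set ι}
    (hz : ∀ i, a i z ≤ b i) (hs : ∀ i ∉ s, a i z < b i) (hw : ∀ i ∈ s, a i w = 0) :
    ∃ ε : ℝ, 0 < ε ∧ ∀ i, a i (z + ε • w) ≤ b i := by
  have h : ∀ i, ∀ᶠ ε : ℝ in nhdsWithin 0 (Set.Ioi 0), a i (z + ε • w) ≤ b i := by
    intro i
    by_cases hi : i ∈ s
    · exact Filter.Eventually.of_forall fun ε => by simpa [hw i hi] using hz i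
    · have hc : Continuous fun ε : ℝ => a i (z + ε • w) := by
        simp only [map_add, map_smul, smul_eq_mul]; fun_prop
      have : ∀ᶠ ε : ℝ in nhds 0, a i (z + ε • w) < b i :=
        hc.continuousAt.eventually_lt_const (by simpa using hs i hi)
      exact (this.filter_mono nhdsWithin_le_nhds).mono fun _ h => h.le
  obtain ⟨ε, h1, h2⟩ := ((Filter.eventually_all.2 h).and self_mem_nhdsWithin).exists
  exact ⟨ε, h2, h1⟩

lemma mem_vectorSpan_of_add_smul_mem {S : Set E} {z w : E} {ε : ℝ} (hε : 0 < ε) (hz : z ∈ S)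
    (h : z + ε • w ∈ S) : w ∈ vectorSpan ℝ S := by
  have := vsub_mem_vectorSpan ℝ h hz
  rw [vsub_eq_sub, add_sub_cancel_left] at this
  exact (Submodule.smul_mem_iff _ hε.ne').1 this

lemma vectorSpan_le_ker {S : Set E} {l : E →ₗ[ℝ] ℝ} {c : ℝ} (h : ∀ x ∈ S, l x = c) :
    vectorSpan ℝ S ≤ LinearMap.ker l := by
  refine Submodule.span_le.2 ?_
  rintro _ ⟨x, hx, y, hy, rfl⟩
  simp [h x hx, h y hy]

lemma vectorSpan_eq_top_of_strict {a : ι → E →ₗ[ℝ] ℝ} {b : ι → ℝ} (h : ∃ x, ∀ i, a i x < b i) :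
    vectorSpan ℝ {x | ∀ i, a i x ≤ b i} = ⊤ := by
  obtain ⟨z, hz⟩ := h
  refine eq_top_iff.2 fun w _ => ?_
  obtain ⟨ε, hε, h⟩ := exists_pos_add_smul_le (s := ∅) (w := w) (fun i => (hz i).le)
    (fun i _ => hz i) (by simp)
  exact mem_vectorSpan_of_add_smul_mem hε (fun i => (hz i).le) h

lemma vectorSpan_tight_eq_ker {a : ι → E →ₗ[ℝ] ℝ} {b : ι → ℝ} {i : ι}
    (h : ∃ x, a i x = b i ∧ ∀ j ≠ i, a j x < b j) :
    vectorSpan ℝ {x | (∀ j, a j x ≤ b j) ∧ a i x = b i} = LinearMap.ker (a i) := by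
  obtain ⟨z, hz, hz'⟩ := h
  have hzle : ∀ j, a j z ≤ b j :=
    forall_le_of_eq_of_forall_ne_lt (x := fun j => a j z) hz hz'
  refine le_antisymm (vectorSpan_le_ker fun x hx => hx.2) fun w hw => ?_
  rw [LinearMap.mem_ker] at hw
  obtain ⟨ε, hε, h⟩ := exists_pos_add_smul_le (s := {i}) (w := w) hzle
    (fun j hj => hz' j hj) (by simpa using hw)
  exact mem_vectorSpan_of_add_smul_mem hε ⟨hzle, hz⟩ ⟨h, by simp [hw, hz]⟩

/-- A convex set of solutions on which no inequality is always tight contains a strict solution. -/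
lemma exists_strict_of_convex {a : ι → E →ₗ[ℝ] ℝ} {b : ι → ℝ} {F : Set E} (hF : Convex ℝ F)
    (hne : F.Nonempty) (hle : ∀ x ∈ F, ∀ i, a i x ≤ b i) (h : ∀ i, ∃ x ∈ F, a i x < b i) :
    ∃ x ∈ F, ∀ i, a i x < b i := by
  classical
  have := Fintype.ofFinite ι
  suffices ∀ s : Finset ι, ∃ x ∈ F, ∀ i ∈ s, a i x < b i by
    obtain ⟨x, hx, h⟩ := this Finset.univ
    exact ⟨x, hx, fun i => h i (Finset.mem_univ i)⟩
  intro s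
  induction s using Finset.induction_on with
  | empty => obtain ⟨x, hx⟩ := hne; exact ⟨x, hx, by simp⟩
  | insert i s _ ih =>
    obtain ⟨x, hx, hxs⟩ := ih
    obtain ⟨y, hy, hyi⟩ := h i
    refine ⟨(1 / 2 : ℝ) • x + (1 / 2 : ℝ) • y,
      hF hx hy (by norm_num) (by norm_num) (by norm_num), fun j hj => ?_⟩
    simp only [map_add, map_smul, smul_eq_mul]
    have hxj := hle x hx j
    have hyj := hle y hy j
    rcases Finset.mem_insert.1 hj with rfl | hj
    · linarith
    · linarith [hxs j hj]

end Facets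

section Euclidean

variable {d : ℕ} {ι : Type*} [Finite ι] {a : ι → EuclideanSpace ℝ (Fin d) →ₗ[ℝ] ℝ} {b : ι → ℝ}

lemma affDim_eq_of_strict (h : ∃ x, ∀ i, a i x < b i) : affDim {x | ∀ i, a i x ≤ b i} = d := by
  rw [affDim, vectorSpan_eq_top_of_strict h, finrank_top, finrank_euclideanSpace_fin]

lemma finrank_ker_add_one {l : EuclideanSpace ℝ (Fin d) →ₗ[ℝ] ℝ} (hl : l ≠ 0) :
    Module.finrank ℝ (LinearMap.ker l) + 1 = d := by
  simpa using Module.Dual.finrank_ker_add_one_of_ne_zero hl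

/-- The facets of a polyhedron with a strict solution, given by a finite system of inequalities in
which for each index some solution makes only that inequality tight, are the solution sets of the
system with one inequality turned into an equation. -/
lemma facetSet_eq_range (hstrict : ∃ x, ∀ i, a i x < b i)
    (hirr : ∀ i, ∃ x, a i x = b i ∧ ∀ j ≠ i, a j x < b j) :
    facetSet {x | ∀ i, a i x ≤ b i} =
      Set.range fun i => {x | (∀ j, a j x ≤ b j) ∧ a i x = b i} := by
  have ha : ∀ i, a i ≠ 0 := by
    rintro i h0
    obtain ⟨x, hx⟩ := hstrict
    obtain ⟨y, hy, -⟩ := hirr i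
    have := hx i
    simp only [h0, LinearMap.zero_apply] at this hy
    linarith
  ext F
  constructor
  · rintro ⟨hne, hexp, hdim⟩
    obtain ⟨l, rfl⟩ := hexp hne
    rw [affDim_eq_of_strict hstrict] at hdim
    set F := {x | x ∈ {x | ∀ i, a i x ≤ b i} ∧ ∀ y ∈ {x | ∀ i, a i x ≤ b i}, l y ≤ l x} with hFdef
    obtain ⟨x₀, hx₀⟩ := hne
    have hconst : ∀ x ∈ F, l x = l x₀ := fun x hx =>
      le_antisymm (hx₀.2 x hx.1) (hx.2 x₀ hx₀.1)
    have hF : Convex ℝ F := by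
      have hP : Convex ℝ {x | ∀ i, a i x ≤ b i} := by
        simp only [Set.ofPred_forall]
        exact convex_iInter fun i => convex_halfSpace_le (a i).isLinear (b i)
      have : F = {x | ∀ i, a i x ≤ b i} ∩ {x | l x = l x₀} := by
        ext x
        refine ⟨fun hx => ⟨hx.1, hconst x hx⟩, fun hx => ⟨hx.1, fun y hy => ?_⟩⟩
        rw [show l x = l x₀ from hx.2]
        exact hx₀.2 y hy
      rw [this]
      exact hP.inter (convex_hyperplane (LinearMap.isLinear l.toLinearMap) _)
    -- Otherwise `F` has a point at which all inequalities are strict; `l` is maximal there, so it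
    -- vanishes and `F` is the whole polyhedron.
    obtain ⟨i, hi⟩ : ∃ i, ∀ x ∈ F, a i x = b i := by
      by_contra! hcon
      obtain ⟨x, hxF, hx⟩ := exists_strict_of_convex hF ⟨x₀, hx₀⟩ (fun x hx => hx.1)
        fun i => (hcon i).imp fun x hx => ⟨hx.1, (hx.1.1 i).lt_of_ne hx.2⟩
      have hl : ∀ w, l w ≤ 0 := by
        intro w
        obtain ⟨ε, hε, h⟩ := exists_pos_add_smul_le (s := ∅) (w := w) (fun i => (hx i).le)
          (fun i _ => hx i) (by simp)
        have := hxF.2 _ h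
        simp only [map_add, map_smul, smul_eq_mul] at this
        exact nonpos_of_mul_nonpos_right (by linarith) hε
      have hl0 : ∀ w, l w = 0 := fun w =>
        le_antisymm (hl w) (by have := hl (-w); rw [map_neg] at this; linarith)
      have : F = {x | ∀ i, a i x ≤ b i} := by
        ext x; simp [hFdef, hl0]
      rw [this, affDim_eq_of_strict hstrict] at hdim
      lia
    refine ⟨i, Set.Subset.antisymm (fun y hy => ?_) fun x hx => ⟨hx.1, hi x hx⟩⟩
    have hspan : vectorSpan ℝ F = LinearMap.ker (a i) := by
      refine Submodule.eq_of_le_of_finrank_eq (vectorSpan_le_ker hi) ?_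
      have := finrank_ker_add_one (ha i)
      exact Nat.add_right_cancel (hdim.trans this.symm)
    have hker : y - x₀ ∈ vectorSpan ℝ F := by
      rw [hspan, LinearMap.mem_ker, map_sub, hy.2, hi x₀ hx₀, sub_self]
    have := vectorSpan_le_ker (l := l.toLinearMap) hconst hker
    have hly : l y = l x₀ := by simpa [sub_eq_zero] using this
    refine ⟨hy.1, fun x hx => ?_⟩
    rw [hly]
    exact hx₀.2 x hx
  · rintro ⟨i, rfl⟩
    refine ⟨?_, fun _ => ⟨LinearMap.toContinuousLinearMap (a i), ?_⟩, ?_⟩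
    · obtain ⟨x, hx, hx'⟩ := hirr i
      exact ⟨x, forall_le_of_eq_of_forall_ne_lt (x := fun j => a j x) hx hx', hx⟩
    · obtain ⟨z, hz, hz'⟩ := hirr i
      have hzle : ∀ j, a j z ≤ b j :=
        forall_le_of_eq_of_forall_ne_lt (x := fun j => a j z) hz hz'
      ext x
      simp only [Set.mem_ofPred_eq, LinearMap.coe_toContinuousLinearMap']
      refine ⟨fun hx => ⟨hx.1, fun y hy => (hy i).trans hx.2.ge⟩, fun hx => ⟨hx.1, ?_⟩⟩
      exact le_antisymm (hx.1 i) (hz ▸ hx.2 z hzle)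
    · rw [affDim_eq_of_strict hstrict, affDim, vectorSpan_tight_eq_ker (hirr i)]
      exact finrank_ker_add_one (ha i)

lemma ncard_facetSet (hstrict : ∃ x, ∀ i, a i x < b i)
    (hirr : ∀ i, ∃ x, a i x = b i ∧ ∀ j ≠ i, a j x < b j) :
    (facetSet {x | ∀ i, a i x ≤ b i}).ncard = Nat.card ι := by
  rw [facetSet_eq_range hstrict hirr, ← Nat.card_coe_set_eq]
  refine (Nat.card_congr (Equiv.ofInjective _ fun i j hij => ?_)).symm
  -- The point at which only inequality `i` is tight lies on no other facet.
  by_contra hne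
  obtain ⟨x, hx, hx'⟩ := hirr i
  have hxi : x ∈ {x | (∀ j, a j x ≤ b j) ∧ a i x = b i} :=
    ⟨forall_le_of_eq_of_forall_ne_lt (x := fun j => a j x) hx hx', hx⟩
  have hxj : x ∈ {x | (∀ j, a j x ≤ b j) ∧ a j x = b j} := hij ▸ hxi
  exact (hx' j (Ne.symm hne)).ne hxj.2

end Euclidean

/-! ### Realization by an orthogonal projection -/

/-- A surjective linear map onto the plane is an orthogonal projection in suitable coordinates:
the coordinates are chosen on the kernel and on a complement of it, and the two parts are declared
orthogonal. -/
lemma exists_isOrthogonalProjection {E : Type*} [AddCommGroup E] [Module ℝ E] [Module.Finite ℝ E]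
    {d : ℕ} (hd : Module.finrank ℝ E = d) (p : E →ₗ[ℝ] EuclideanSpace ℝ (Fin 2))
    (hp : Function.Surjective p) :
    ∃ (Φ : E ≃ₗ[ℝ] EuclideanSpace ℝ (Fin d))
      (f : EuclideanSpace ℝ (Fin d) →ₗ[ℝ] EuclideanSpace ℝ (Fin 2)),
      IsOrthogonalProjection f ∧ ∀ x, f (Φ x) = p x := by
  obtain ⟨W, hW⟩ := Submodule.exists_isCompl (LinearMap.ker p)
  let e₁ : E ≃ₗ[ℝ] LinearMap.ker p × EuclideanSpace ℝ (Fin 2) :=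
    LinearMap.equivProdOfSurjectiveOfIsCompl ((LinearMap.ker p).projectionOnto W hW) p
      (Submodule.range_projectionOnto hW)
      (LinearMap.range_eq_top.2 hp)
      (by rw [Submodule.ker_projectionOnto]; exact hW.symm)
  let e₂ : LinearMap.ker p ≃ₗ[ℝ] EuclideanSpace ℝ (Fin (Module.finrank ℝ (LinearMap.ker p))) :=
    LinearEquiv.ofFinrankEq _ _ (by simp)
  let X := WithLp 2 (EuclideanSpace ℝ (Fin (Module.finrank ℝ (LinearMap.ker p))) ×
    EuclideanSpace ℝ (Fin 2))
  let e₃ : E ≃ₗ[ℝ] X := (e₁.trans (e₂.prodCongr (LinearEquiv.refl ℝ _))).trans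
    (WithLp.linearEquiv 2 ℝ _).symm
  have hX : Module.finrank ℝ X = d := e₃.finrank_eq.symm.trans hd
  let iso : X ≃ₗᵢ[ℝ] EuclideanSpace ℝ (Fin d) :=
    ((stdOrthonormalBasis ℝ X).reindex (finCongr hX)).repr
  let f : EuclideanSpace ℝ (Fin d) →ₗ[ℝ] EuclideanSpace ℝ (Fin 2) :=
    LinearMap.snd ℝ _ _ ∘ₗ (WithLp.linearEquiv 2 ℝ _).toLinearMap ∘ₗ
      iso.symm.toLinearEquiv.toLinearMap
  refine ⟨e₃.trans iso.toLinearEquiv, f, ?_, fun x => ?_⟩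
  · -- The adjoint of `f` is an isometric embedding, with the plane of projection as its range.
    let g₀ : EuclideanSpace ℝ (Fin 2) →ₗ[ℝ] EuclideanSpace ℝ (Fin d) :=
      iso.toLinearEquiv.toLinearMap ∘ₗ (WithLp.linearEquiv 2 ℝ _).symm.toLinearMap ∘ₗ
        LinearMap.inr ℝ _ _
    let g : EuclideanSpace ℝ (Fin 2) →ₗᵢ[ℝ] EuclideanSpace ℝ (Fin d) :=
      { g₀ with
        norm_map' := fun y => by
          change ‖iso (WithLp.toLp 2 (0, y))‖ = ‖y‖
          rw [LinearIsometryEquiv.norm_map]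
          exact WithLp.norm_toLp_snd 2 _ _ y }
    have hfg : ∀ y, f (g y) = y := fun y => by
      change (iso.symm (iso (WithLp.toLp 2 (0, y)))).snd = y
      rw [LinearIsometryEquiv.symm_apply_apply]
      rfl
    have hadj : ∀ y x, inner ℝ (g y) x = inner ℝ y (f x) := fun y x => by
      change inner ℝ (iso (WithLp.toLp 2 (0, y))) x = inner ℝ y (iso.symm x).snd
      rw [← LinearIsometryEquiv.inner_map_map iso.symm, LinearIsometryEquiv.symm_apply_apply,
        WithLp.prod_inner_apply]
      simp
    refine ⟨LinearMap.range g.toLinearMap, g.equivRange.symm, fun x => ?_⟩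
    rw [LinearIsometryEquiv.eq_symm_apply]
    refine Subtype.ext
      (Submodule.eq_starProjection_of_mem_of_inner_eq_zero (v := g (f x))
        (LinearMap.mem_range_self g.toLinearMap (f x)) ?_).symm
    rintro _ ⟨y, rfl⟩
    rw [real_inner_comm]
    change inner ℝ (g y) (x - g (f x)) = 0
    rw [hadj, map_sub, hfg, sub_self, inner_zero_right]
  · change (iso.symm (iso (e₃ x))).snd = p x
    rw [LinearIsometryEquiv.symm_apply_apply]
    rfl

/-! ### Rescaling and counting -/

/-- The linear change of coordinates of the plane that maps the points `(t, t²)` to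
`parabolaPoint (t / s)`. -/
noncomputable def rescale (s : ℝ) : ℝ × ℝ →ₗ[ℝ] EuclideanSpace ℝ (Fin 2) where
  toFun z := !₂[z.1 / s, z.2 / s ^ 2 - z.1 / s]
  map_add' z z' := by
    ext i; fin_cases i
    · simp; ring
    · simp; ring
  map_smul' c z := by
    ext i; fin_cases i
    · simp; ring
    · simp; ring

lemma rescale_sq (s t : ℝ) : rescale s (t, t ^ 2) = parabolaPoint (t / s) := by
  simp [rescale, parabolaPoint, div_pow]

lemma rescale_surjective {s : ℝ} (hs : s ≠ 0) : Function.Surjective (rescale s) := by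
  intro y
  refine ⟨(s * y 0, s ^ 2 * (y 1 + y 0)), ?_⟩
  ext i; fin_cases i
  · simp [rescale]; field_simp
  · simp [rescale]; field_simp; ring

/-- Points that a linear map sends to distinct points of the standard parabola are in convex
position: the tangent of the parabola at `(t, t²)` separates the point over it from all others. -/
lemma extremePoints_convexHull_of_parabola {E : Type*} [AddCommGroup E] [Module ℝ E] {M : ℕ}
    {p : E →ₗ[ℝ] ℝ × ℝ} {v : ℕ → E} (hp : ∀ t < M, p (v t) = ((t : ℝ), (t : ℝ) ^ 2)) :
    (convexHull ℝ (v '' Set.Iio M)).extremePoints ℝ = v '' Set.Iio M := by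
  refine Set.Subset.antisymm extremePoints_convexHull_subset ?_
  rintro _ ⟨t, ht, rfl⟩
  have ht' : t < M := ht
  refine ⟨subset_convexHull ℝ _ ⟨t, ht, rfl⟩, fun x hx y hy hxy => ?_⟩
  -- `h` is the height above the tangent, up to a constant.
  let h : E →ₗ[ℝ] ℝ := LinearMap.snd ℝ ℝ ℝ ∘ₗ p - (2 * (t : ℝ)) • LinearMap.fst ℝ ℝ ℝ ∘ₗ p
  have hh : ∀ s < M, h (v s) = ((s : ℝ) - t) ^ 2 - t ^ 2 := fun s hs => by
    simp only [h, LinearMap.sub_apply, LinearMap.smul_apply, LinearMap.comp_apply, hp s hs,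
      LinearMap.fst_apply, LinearMap.snd_apply, smul_eq_mul]
    ring
  have htt : h (v t) = -(t : ℝ) ^ 2 := by rw [hh t ht']; ring
  have hconv : Convex ℝ {x | x = v t ∨ h (v t) < h x} := by
    intro x hx y hy α β hα hβ hαβ
    obtain rfl : β = 1 - α := by linarith
    rcases hα.eq_or_lt with rfl | hα'
    · simpa using hy
    rcases hβ.eq_or_lt with hβ' | hβ'
    · obtain rfl : α = 1 := by linarith
      simpa using hx
    rcases hx with rfl | hx <;> rcases hy with rfl | hy
    · left; rw [← add_smul]; simp
    all_goals
      right
      simp only [map_add, map_smul, smul_eq_mul]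
      nlinarith
  have hsub : convexHull ℝ (v '' Set.Iio M) ⊆ {x | x = v t ∨ h (v t) < h x} := by
    refine convexHull_min ?_ hconv
    rintro _ ⟨s, hs, rfl⟩
    by_cases hst : s = t
    · left; rw [hst]
    · right
      have : ((s : ℝ) - t) ≠ 0 := sub_ne_zero.2 (by exact_mod_cast hst)
      rw [hh s hs, htt]
      have := sq_pos_of_ne_zero this
      linarith
  obtain ⟨α, β, hα, hβ, hαβ, hsum⟩ := hxy
  have hval : α * h x + β * h y = h (v t) := by
    rw [← hsum]; simp
  have hx' := hsub hx
  have hy' := hsub hy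
  have hβ' : β = 1 - α := by linarith
  rcases hx' with rfl | hx'
  · rfl
  · exfalso
    have hyle : h (v t) ≤ h y := by
      rcases hy' with rfl | hy'
      exacts [le_rfl, hy'.le]
    subst hβ'
    nlinarith

theorem theorem3p6 (n d : ℕ) (hd : Even d) (hdvd : 2 * d ∣ n)
    (heven : Even (n / (2 * d))) (htwo : 2 ≤ n / (2 * d)) :
    ∃ (P : Set (EuclideanSpace ℝ (Fin d)))
      (f : EuclideanSpace ℝ (Fin d) →ₗ[ℝ] EuclideanSpace ℝ (Fin 2)),
      IsPolytope P ∧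
      affDim P = d ∧
      (facetSet P).ncard = n / 2 ∧
      (vertexSet P).ncard = (n / d) ^ (d / 2) ∧
      IsOrthogonalProjection f ∧
      f '' P = convexHull ℝ (parabolaPoints ((n / d) ^ (d / 2))) ∧
      f '' vertexSet P = parabolaPoints ((n / d) ^ (d / 2)) := by
  have hd0 : d ≠ 0 := by rintro rfl; simp at htwo
  obtain ⟨c, rfl⟩ := hdvd
  rw [Nat.mul_div_cancel_left _ (by lia)] at htwo heven
  obtain ⟨k, rfl⟩ := hd
  have hk : k ≠ 0 := by lia
  have hnd : 2 * (k + k) * c / (k + k) = (2 * c - 1) + 1 := by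
    rw [show 2 * (k + k) * c = (k + k) * (2 * c) by ring, Nat.mul_div_cancel_left _ (by lia)]
    lia
  have hn2 : 2 * (k + k) * c / 2 = k * ((2 * c - 1) + 1) := by
    rw [show 2 * (k + k) * c = 2 * (k * (2 * c)) by ring, Nat.mul_div_cancel_left _ (by lia)]
    congr 1
    lia
  have hk2 : (k + k) / 2 = k := by lia
  rw [hnd, hn2, hk2]
  have hK : Odd (2 * c - 1) := ⟨c - 1, by lia⟩
  obtain ⟨E, _, _, ι, p, v, a, b, _, hrank, _, hcard, hsurj, h⟩ :=
    exists_isParabolicPolytope hK (by lia) k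
  set M := ((2 * c - 1) + 1) ^ k
  have hM : (M : ℝ) - 1 ≠ 0 := by
    have : 1 < M := Nat.one_lt_pow hk (by lia)
    exact sub_ne_zero.2 (by exact_mod_cast this.ne')
  obtain ⟨Φ, f, hf, hfΦ⟩ := exists_isOrthogonalProjection (d := k + k) (by rw [hrank]; ring)
    (rescale ((M : ℝ) - 1) ∘ₗ p) ((rescale_surjective hM).comp (hsurj hk))
  -- The polytope, transported by `Φ`, with its vertices and its inequalities.
  set w : ℕ → EuclideanSpace ℝ (Fin (k + k)) := fun t => Φ (v t)
  set a' : ι → EuclideanSpace ℝ (Fin (k + k)) →ₗ[ℝ] ℝ := fun i => a i ∘ₗ Φ.symm.toLinearMap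
  have hw : ∀ t < M, (p ∘ₗ Φ.symm.toLinearMap) (w t) = ((t : ℝ), (t : ℝ) ^ 2) := fun t ht => by
    simp [w, h.proj t ht]
  have hP : convexHull ℝ (w '' Set.Iio M) = {x | ∀ i, a' i x ≤ b i} := by
    have hwv : w '' Set.Iio M = Φ.toLinearMap '' (v '' Set.Iio M) := (Set.image_image _ _ _).symm
    rw [hwv, ← LinearMap.image_convexHull, h.hull]
    ext x
    constructor
    · rintro ⟨y, hy, rfl⟩
      intro i
      simpa [a'] using hy i
    · intro hx
      exact ⟨Φ.symm x, hx, by simp⟩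
  have hstrict : ∃ x, ∀ i, a' i x < b i := by
    obtain ⟨x, hx⟩ := h.strict
    exact ⟨Φ x, fun i => by simpa [a'] using hx i⟩
  have hirr : ∀ i, ∃ x, a' i x = b i ∧ ∀ j ≠ i, a' j x < b j := fun i => by
    obtain ⟨x, hx, hx'⟩ := h.irredundant i
    exact ⟨Φ x, by simpa [a'] using hx, fun j hj => by simpa [a'] using hx' j hj⟩
  have hvert : vertexSet (convexHull ℝ (w '' Set.Iio M)) = w '' Set.Iio M :=
    extremePoints_convexHull_of_parabola hw
  have hfw : f '' (w '' Set.Iio M) = parabolaPoints M := by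
    have key : ∀ t < M, f (w t) = parabolaPoint ((t : ℝ) / ((M : ℝ) - 1)) := fun t ht => by
      rw [hfΦ, LinearMap.comp_apply, h.proj t ht, rescale_sq]
    ext y
    constructor
    · rintro ⟨_, ⟨t, ht, rfl⟩, rfl⟩
      exact ⟨t, ht, key t ht⟩
    · rintro ⟨t, ht, rfl⟩
      exact ⟨w t, ⟨t, ht, rfl⟩, key t ht⟩
  have hinj : Set.InjOn w (Set.Iio M) := fun s hs t ht hst => by
    have := (hw s hs).symm.trans ((congrArg _ hst).trans (hw t ht))
    exact Nat.cast_injective (congrArg Prod.fst this)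
  refine ⟨convexHull ℝ (w '' Set.Iio M), f, ⟨_, (Set.finite_Iio M).image w, rfl⟩, ?_, ?_, ?_, hf,
    ?_, ?_⟩
  · rw [hP, affDim_eq_of_strict hstrict]
  · rw [hP, ncard_facetSet hstrict hirr, hcard]
  · rw [hvert, hinj.ncard_image, ← Nat.card_coe_set_eq]
    simp
  · rw [LinearMap.image_convexHull, hfw]
  · rw [hvert, hfw]
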